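/- A symmetric real matrix is diagonally dominant if each diagonal entry is at least the sum of the absolute values of the other entries in its row; an SDDM matrix is a positive definite, symmetric, diagonally dominant matrix with non-positive off-diagonal entries. The condition number of a positive definite matrix is the ratio of its largest eigenvalue to its smallest. Write $X \succ Y$ (resp. $X \succcurlyeq Y$) if $X-Y$ is positive definite (resp. positive semidefinite), and write $X \approx_\epsilon Y$ if $e^{\epsilon} X \succcurlyeq Y \succcurlyeq e^{-\epsilon} X$. For $d \ge 0$, sequences $D_1,\dots,D_d$ and $A_1,\dots,A_d$ of $n\times n$ real matrices are an approximate inverse chain for $M_0 = D_0 - A_0$ if for all $0\le i\le d$ the matrix $D_i$ is nonnegative diagonal, $A_i$ is symmetric with nonnegative entries and $M_i = D_i - A_i \succ 0$, and there are real numbers $\epsilon_0,\dots,\epsilon_d$ with $\sum_{i=0}^d \epsilon_i \le 2$ such that (a) $M_i \approx_{\epsilon_{i-1}} D_{i-1} - A_{i-1} D_{i-1}^{-1} A_{i-1}$ for all $1\le i\le d$; (b) $D_i \approx_{\epsilon_{i-1}} D_{i-1}$ for all $1\le i\le d$; (c) $D_d \approx_{\epsilon_d} M_d$. **Theorem.**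 There is an absolute constant $C > 0$ such that the following holds for every $n \ge 1$ and every real $\kappa$. Let $M_0 = D_0 - A_0$ be an $n$-dimensional SDDM matrix with condition number at most $\kappa$, where $D_0$ is diagonal and $A_0$ has nonnegative entries and zero diagonal (so $D_0$ is the diagonal part of $M_0$ and $-A_0$ its off-diagonal part). Then $M_0$ has an approximate inverse chain $D_1,\dots,D_d$ and $A_1,\dots,A_d$ with $d \le C\log\kappa$, and the total number of nonzero entries in the matrices $D_1,\dots,D_d,A_1,\dots,A_d$ is at most $C\,n\log^3\kappa$. -/

import Mathlib

open scoped Matrix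

namespace InverseChain

variable {n : ℕ}

/-- A square matrix with nonnegative entries. -/
def EntrywiseNonneg (A : Matrix (Fin n) (Fin n) ℝ) : Prop :=
  ∀ i j, 0 ≤ A i j

/-- SDD: a symmetric matrix each of whose diagonal entries is at least the sum of the absolute
values of the other entries in its row. -/
structure IsSDD (M : Matrix (Fin n) (Fin n) ℝ) : Prop where
  symm : M.IsSymm
  dominant : ∀ i, ∑ j ∈ Finset.univ.erase i, |M i j| ≤ M i i

/-- SDDM: a positive definite SDD matrix with nonpositive off-diagonal entries. -/
structure IsSDDM (M : Matrix (Fin n) (Fin n) ℝ) : Prop where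
  sdd : IsSDD M
  posDef : M.PosDef
  offDiag_nonpos : ∀ i j, i ≠ j → M i j ≤ 0

/-- The condition number of a positive definite matrix of positive dimension: the ratio of its
largest eigenvalue to its smallest. -/
noncomputable def condNumber (M : Matrix (Fin n) (Fin n) ℝ) : ℝ :=
  sSup (spectrum ℝ M) / sInf (spectrum ℝ M)

/-- `Approx ε X Y`: in the Loewner order, `exp ε • X ≽ Y ≽ exp (-ε) • X`. -/
def Approx (ε : ℝ) (X Y : Matrix (Fin n) (Fin n) ℝ) : Prop :=
  (Real.exp ε • X - Y).PosSemidef ∧ (Y - Real.exp (-ε) • X).PosSemidef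

/-- The number of nonzero entries of a matrix. -/
noncomputable def nnz (M : Matrix (Fin n) (Fin n) ℝ) : ℕ :=
  {p : Fin n × Fin n | M p.1 p.2 ≠ 0}.ncard

/-- The sequences `D 1, …, D d` and `A 1, …, A d` are an approximate inverse chain for
`D 0 - A 0`. Terms of index greater than `d` play no role. -/
structure IsApproxInverseChain (d : ℕ) (D A : ℕ → Matrix (Fin n) (Fin n) ℝ) : Prop where
  isDiag : ∀ i ≤ d, (D i).IsDiag
  diag_nonneg : ∀ i ≤ d, EntrywiseNonneg (D i)
  symm : ∀ i ≤ d, (A i).IsSymm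
  nonneg : ∀ i ≤ d, EntrywiseNonneg (A i)
  posDef : ∀ i ≤ d, (D i - A i).PosDef
  approx : ∃ ε : ℕ → ℝ, ∑ i ∈ Finset.range (d + 1), ε i ≤ 2 ∧
    (∀ i < d, Approx (ε i) (D (i + 1) - A (i + 1)) (D i - A i * (D i)⁻¹ * A i)) ∧
    (∀ i < d, Approx (ε i) (D (i + 1)) (D i)) ∧
    Approx (ε d) (D d) (D d - A d)

/-- The total number of nonzero entries in `D 1, …, D d` and `A 1, …, A d`. -/
noncomputable def chainSize (d : ℕ) (D A : ℕ → Matrix (Fin n) (Fin n) ℝ) : ℕ :=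
  ∑ i ∈ Finset.Icc 1 d, (nnz (D i) + nnz (A i))

end InverseChain

namespace InverseChain

open Matrix

/-! ### Traces of shifted inverses and their rank-one updates. -/

section Barrier

variable {ι m : Type*} [Fintype ι] [Fintype m]

/-! Each level replaces `D - A` by `D - A * D⁻¹ * A` and then sparsifies. Call lam a gap when `D - A
≽ lam • D`. Since `A` is nonnegative, a gap bounds the spectrum of `A` relative to `D` in absolute
value by 1 - lam. Squaring makes this (1 - lam)^2, so a gap of at most 1/2 grows by at least 3/2
(`gap_mul_inv_mul`). Squaring also preserves nonpositive off-diagonal entries and nonnegative row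
sums.

Sparsification must keep that structure. Such a matrix is a nonnegative combination of rank-one
forms on edges and loops, and the Batson–Spielman–Srivastava barrier argument (`exists_step`,
`exists_sparsifier`) reweights them so that O(n / ε^2) survive (`exists_sparse_approx`). With ε = 1
/ d the gap loses only a factor exp (-2 / d) per level, so it still grows geometrically from at
least 1 / κ and reaches 1/2 after d = O(log κ) levels. The first d errors sum to 1, the final
comparison costs 1, and d levels of size O(n d^2) give O(n d^3). -/

theorem sum_inv_sub_sum_inv_add_pos [Nonempty m] {x : m → ℝ} (hx : ∀ i, 0 < x i) {δ : ℝ}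
    (hδ : 0 < δ) : 0 < ∑ i, (x i)⁻¹ - ∑ i, (x i + δ)⁻¹ := by
  rw [sub_pos]
  refine Finset.sum_lt_sum_of_nonempty Finset.univ_nonempty fun i _ => ?_
  exact inv_strictAnti₀ (hx i) (by linarith)

theorem mul_sum_inv_sq_le {x : m → ℝ} (hx : ∀ i, 0 < x i) {δ : ℝ} (hδ : 0 < δ) :
    δ * ∑ i, ((x i + δ)⁻¹) ^ 2 ≤ ∑ i, (x i)⁻¹ - ∑ i, (x i + δ)⁻¹ := by
  rw [Finset.mul_sum, ← Finset.sum_sub_distrib]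
  refine Finset.sum_le_sum fun i _ => ?_
  have h := hx i
  have e : (x i)⁻¹ - (x i + δ)⁻¹ - δ * ((x i + δ)⁻¹) ^ 2 = δ ^ 2 / (x i * (x i + δ) ^ 2) := by
    field_simp; ring
  have : 0 ≤ δ ^ 2 / (x i * (x i + δ) ^ 2) := by positivity
  linarith

/-- The Cauchy–Schwarz inequality behind the shift of the lower barrier. -/
theorem mul_one_add_le_sum_inv_sq {x : m → ℝ} (hx : ∀ i, 0 < x i)
    (hs : ∑ i, (x i + 1)⁻¹ ≤ 1) :
    (∑ i, (x i)⁻¹ - ∑ i, (x i + 1)⁻¹) * (1 + (∑ i, (x i)⁻¹ - ∑ i, (x i + 1)⁻¹)) ≤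
      ∑ i, ((x i)⁻¹) ^ 2 := by
  set g := ∑ i, (x i)⁻¹ - ∑ i, (x i + 1)⁻¹ with hg
  have hg' : g = ∑ i, (x i)⁻¹ * (x i + 1)⁻¹ := by
    rw [hg, ← Finset.sum_sub_distrib]
    refine Finset.sum_congr rfl fun i _ => ?_
    have := hx i
    field_simp; ring
  set R := ∑ i, ((x i)⁻¹) ^ 2 * (x i + 1)⁻¹ with hR
  have hR0 : 0 ≤ R := Finset.sum_nonneg fun i _ => by have := hx i; positivity
  have hdiff : ∑ i, ((x i)⁻¹) ^ 2 = g + R := by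
    rw [hg', hR, ← Finset.sum_add_distrib]
    refine Finset.sum_congr rfl fun i _ => ?_
    have := hx i
    field_simp
  -- Splitting each squared term of `g` as a term of `R` times `(x i + 1)⁻¹` gives g^2 ≤ R, as the
  -- second sum is at most 1.
  have hcs : g ^ 2 ≤ R * ∑ i, (x i + 1)⁻¹ := by
    rw [hg', hR]
    refine Finset.sum_sq_le_sum_mul_sum_of_sq_le_mul _ (fun i _ => ?_) (fun i _ => ?_) fun i _ => le_of_eq ?_
    · have := hx i; positivity
    · have := hx i; positivity
    · ring
  nlinarith

variable [DecidableEq m]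

/-- The eigenvalues of a symmetric matrix govern definiteness of its shifts and the traces of their
inverses. -/
theorem exists_eigenvalues {A : Matrix m m ℝ} (hA : A.IsHermitian) :
    ∃ μ : m → ℝ, (∀ c : ℝ, (A - c • 1).PosDef ↔ ∀ i, c < μ i) ∧
      ∀ c : ℝ, (∀ i, μ i ≠ c) → trace (A - c • 1)⁻¹ = ∑ i, (μ i - c)⁻¹ ∧
        trace ((A - c • 1)⁻¹ * (A - c • 1)⁻¹) = ∑ i, ((μ i - c)⁻¹) ^ 2 := by
  set U : Matrix m m ℝ := (hA.eigenvectorUnitary : Matrix m m ℝ) with hU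
  have h1 : U * star U = 1 := Unitary.coe_mul_star_self _
  have h2 : star U * U = 1 := Unitary.coe_star_mul_self _
  have hspec : A = U * diagonal hA.eigenvalues * star U := by
    have := hA.spectral_theorem
    rw [Unitary.conjStarAlgAut_apply] at this
    simpa using this
  set μ := hA.eigenvalues with hμ
  have hmul : ∀ f g : m → ℝ, (U * diagonal f * star U) * (U * diagonal g * star U) =
      U * diagonal (fun i => f i * g i) * star U := by
    intro f g
    calc _ = U * diagonal f * (star U * U) * diagonal g * star U := by simp only [mul_assoc]
      _ = _ := by rw [h2, mul_one, mul_assoc U, diagonal_mul_diagonal]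
  have hone : U * diagonal (fun _ => (1 : ℝ)) * star U = 1 := by
    rw [diagonal_one, mul_one, h1]
  have htr : ∀ f : m → ℝ, trace (U * diagonal f * star U) = ∑ i, f i := by
    intro f
    rw [trace_mul_comm, ← mul_assoc, h2, one_mul, trace_diagonal]
  have hshift : ∀ c : ℝ, A - c • 1 = U * diagonal (fun i => μ i - c) * star U := by
    intro c
    have : diagonal (fun i => μ i - c) = diagonal μ - c • (1 : Matrix m m ℝ) := by
      rw [smul_one_eq_diagonal, diagonal_sub]
    rw [this, mul_sub, sub_mul, ← hspec, mul_smul_comm, mul_one, smul_mul_assoc, h1]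
  refine ⟨μ, fun c => ?_, fun c hc => ?_⟩
  · rw [hshift c]
    have hUu : IsUnit U := ⟨⟨U, star U, h1, h2⟩, rfl⟩
    rw [hUu.posDef_star_right_conjugate_iff, posDef_diagonal_iff]
    simp
  · have hinv : (A - c • 1)⁻¹ = U * diagonal (fun i => (μ i - c)⁻¹) * star U := by
      apply inv_eq_right_inv
      rw [hshift c, hmul, ← hone]
      congr 3
      ext i
      exact mul_inv_cancel₀ (sub_ne_zero.2 (hc i))
    rw [hinv, hmul, htr, htr]
    simp [sq]

/-- Only negative `t` is delicate: by Cauchy–Schwarz in the inner product of `N`, the square of `v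
⬝ᵥ x` is at most `v ⬝ᵥ N⁻¹ *ᵥ v` times `x ⬝ᵥ N *ᵥ x`. The proof evaluates the form at one suitable
vector. -/
theorem posDef_add_smul_vecMulVec {N : Matrix m m ℝ} (hN : N.PosDef) (v : m → ℝ) {t : ℝ}
    (ht : 0 < 1 + t * (v ⬝ᵥ N⁻¹ *ᵥ v)) : (N + t • vecMulVec v v).PosDef := by
  have hherm : (t • vecMulVec v v).IsHermitian := by
    ext i j; simp [vecMulVec_apply, mul_comm]
  refine .of_dotProduct_mulVec_pos (hN.1.add hherm) fun x hx => ?_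
  have hquad : star x ⬝ᵥ ((N + t • vecMulVec v v) *ᵥ x) =
      x ⬝ᵥ N *ᵥ x + t * (v ⬝ᵥ x) ^ 2 := by
    rw [star_trivial, add_mulVec, smul_mulVec, vecMulVec_mulVec, dotProduct_add, dotProduct_smul,
      op_smul_eq_smul, dotProduct_smul, dotProduct_comm x v]
    simp only [smul_eq_mul]; ring
  rw [hquad]
  have hxx : 0 < x ⬝ᵥ N *ᵥ x := by simpa using hN.dotProduct_mulVec_pos hx
  rcases le_or_gt 0 t with h0 | h0
  · positivity
  by_cases hvx : v ⬝ᵥ x = 0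
  · simpa [hvx] using hxx
  set y := N⁻¹ *ᵥ v with hy
  have hNy : N *ᵥ y = v := by
    rw [hy, mulVec_mulVec, mul_nonsing_inv _ ((isUnit_iff_isUnit_det N).1 hN.isUnit), one_mulVec]
  have hyN : y ⬝ᵥ N *ᵥ x = v ⬝ᵥ x := by
    have hT : Nᵀ = N := by simpa using hN.1.eq
    rw [dotProduct_mulVec, ← mulVec_transpose, hT, hNy]
  have hz := hN.posSemidef.dotProduct_mulVec_nonneg (x + (t * (v ⬝ᵥ x)) • y)
  rw [star_trivial, mulVec_add, mulVec_smul, hNy, add_dotProduct, dotProduct_add, dotProduct_add,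
    smul_dotProduct, smul_dotProduct, dotProduct_smul, dotProduct_smul, hyN, dotProduct_comm x v,
    dotProduct_comm y v] at hz
  simp only [smul_eq_mul] at hz
  have hs : 0 < (v ⬝ᵥ x) ^ 2 := by positivity
  nlinarith [mul_pos (mul_pos (neg_pos.2 h0) ht) hs]

/-- Trace of the Sherman–Morrison formula. -/
theorem trace_inv_add_smul_vecMulVec {N : Matrix m m ℝ} (hN : N.PosDef) (v : m → ℝ) {t : ℝ}
    (ht : 0 < 1 + t * (v ⬝ᵥ N⁻¹ *ᵥ v)) :
    trace (N + t • vecMulVec v v)⁻¹ =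
      trace N⁻¹ - t * (v ⬝ᵥ (N⁻¹ * N⁻¹) *ᵥ v) / (1 + t * (v ⬝ᵥ N⁻¹ *ᵥ v)) := by
  set y := N⁻¹ *ᵥ v with hy
  set q := v ⬝ᵥ y with hq
  have hdet := (isUnit_iff_isUnit_det N).1 hN.isUnit
  have hT : (N⁻¹)ᵀ = N⁻¹ := by simpa using hN.inv.1.eq
  have hvN : v ᵥ* N⁻¹ = y := by rw [← mulVec_transpose, hT]
  have hNy : N *ᵥ y = v := by rw [hy, mulVec_mulVec, mul_nonsing_inv _ hdet, one_mulVec]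
  have hinv : (N + t • vecMulVec v v)⁻¹ = N⁻¹ - (t / (1 + t * q)) • vecMulVec y y := by
    apply inv_eq_right_inv
    rw [mul_sub, add_mul, add_mul, mul_nonsing_inv _ hdet, smul_mul_assoc, vecMulVec_mul, hvN,
      mul_smul_comm, mul_smul_comm, mul_vecMulVec, hNy, smul_mul_assoc, vecMulVec_mul_vecMulVec,
      ← hq, vecMulVec_smul, smul_smul, smul_smul, add_sub_assoc, ← add_smul, ← sub_smul]
    have : t - (t / (1 + t * q) + t / (1 + t * q) * (t * q)) = 0 := by
      field_simp; ring
    rw [mul_assoc, this, zero_smul, add_zero]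
  rw [hinv, trace_sub, trace_smul, trace_vecMulVec, ← mulVec_mulVec, ← hy, dotProduct_mulVec v, hvN]
  simp only [smul_eq_mul]
  ring

theorem sum_dotProduct_mulVec {v : ι → m → ℝ} (hv : ∑ i, vecMulVec (v i) (v i) = 1)
    (B : Matrix m m ℝ) : ∑ i, v i ⬝ᵥ B *ᵥ v i = trace B := by
  have : ∀ i, v i ⬝ᵥ B *ᵥ v i = trace (B * vecMulVec (v i) (v i)) := by
    intro i
    rw [mul_vecMulVec, trace_vecMulVec, dotProduct_comm]
  simp_rw [this]
  rw [← trace_sum, ← Finset.mul_sum, hv, mul_one]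

end Barrier

/-! ### The barrier step and sparsification of the identity. -/

section Step

variable {ι m : Type*} [Fintype ι] [Fintype m]

theorem dotProduct_mulVec_nonneg {N : Matrix m m ℝ} (hN : N.PosSemidef) (v : m → ℝ) :
    0 ≤ v ⬝ᵥ N *ᵥ v := by
  simpa using hN.dotProduct_mulVec_nonneg v

variable [DecidableEq m]

/-- A symmetric matrix kept between two barriers, as measured by the traces of the inverses. -/
structure BetweenBarriers (a l u : ℝ) (A : Matrix m m ℝ) : Prop where
  isHermitian : A.IsHermitian
  upper_posDef : (u • 1 - A).PosDef
  lower_posDef : (A - l • 1).PosDef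
  upper_trace : trace (u • 1 - A)⁻¹ ≤ a
  lower_trace : trace (A - l • 1)⁻¹ ≤ a

theorem posSemidef_inv_mul_inv {N : Matrix m m ℝ} (hN : N.PosDef) : (N⁻¹ * N⁻¹).PosSemidef := by
  have := posSemidef_conjTranspose_mul_self N⁻¹
  rwa [hN.inv.1.eq] at this

/-- The upper barrier may be moved from `u` to `u + δ`. -/
theorem BetweenBarriers.upper_shift [Nonempty m] {a l u δ : ℝ} {A : Matrix m m ℝ}
    (h : BetweenBarriers a l u A) (hδ : 0 < δ) :
    ((u + δ) • 1 - A).PosDef ∧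
      trace ((u + δ) • 1 - A)⁻¹ < trace (u • 1 - A)⁻¹ ∧
      δ * trace (((u + δ) • 1 - A)⁻¹ * ((u + δ) • 1 - A)⁻¹) ≤
        trace (u • 1 - A)⁻¹ - trace ((u + δ) • 1 - A)⁻¹ := by
  -- Passing to `-A` turns the upper barrier into a lower one.
  obtain ⟨μ, hpd, htr⟩ := exists_eigenvalues h.isHermitian.neg
  have hform : ∀ c : ℝ, c • 1 - A = -A - (-c) • 1 := by
    intro c; rw [neg_smul]; abel
  have hu := (hpd (-u)).1 (hform u ▸ h.upper_posDef)
  have hu' : ∀ i, -(u + δ) < μ i := fun i => by linarith [hu i]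
  have hx : ∀ i, 0 < μ i - -u := fun i => by linarith [hu i]
  have e : ∀ i, μ i - -(u + δ) = (μ i - -u) + δ := fun i => by ring
  rw [hform, hform, (htr _ fun i => (hu i).ne').1, (htr _ fun i => (hu' i).ne').1,
    (htr _ fun i => (hu' i).ne').2]
  simp_rw [e]
  exact ⟨(hpd _).2 hu', sub_pos.1 (sum_inv_sub_sum_inv_add_pos hx hδ), mul_sum_inv_sq_le hx hδ⟩

/-- The lower barrier may be moved from `l` to `l + 1`. -/
theorem BetweenBarriers.lower_shift [Nonempty m] {a l u : ℝ} {A : Matrix m m ℝ}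
    (h : BetweenBarriers a l u A) (ha : a < 1) :
    (A - (l + 1) • 1).PosDef ∧
      trace (A - l • 1)⁻¹ < trace (A - (l + 1) • 1)⁻¹ ∧
      (trace (A - (l + 1) • 1)⁻¹ - trace (A - l • 1)⁻¹) *
          (1 + (trace (A - (l + 1) • 1)⁻¹ - trace (A - l • 1)⁻¹)) ≤
        trace ((A - (l + 1) • 1)⁻¹ * (A - (l + 1) • 1)⁻¹) := by
  obtain ⟨μ, hpd, htr⟩ := exists_eigenvalues h.isHermitian
  have hl := (hpd l).1 h.lower_posDef
  have hsum := h.lower_trace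
  rw [(htr _ fun i => (hl i).ne').1] at hsum
  -- One reciprocal is at most the whole trace, which is below 1, so every eigenvalue is more than 1
  -- above `l`.
  have hl' : ∀ i, l + 1 < μ i := by
    intro i
    have h1 : (μ i - l)⁻¹ ≤ ∑ j, (μ j - l)⁻¹ :=
      Finset.single_le_sum (f := fun j => (μ j - l)⁻¹)
        (fun j _ => (inv_pos.2 (sub_pos.2 (hl j))).le) (Finset.mem_univ i)
    have h2 : (μ i - l)⁻¹ < 1 := by linarith
    have h3 := (inv_lt_one₀ (sub_pos.2 (hl i))).1 h2
    linarith
  have hx : ∀ i, 0 < μ i - (l + 1) := fun i => sub_pos.2 (hl' i)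
  have e : ∀ i, μ i - l = (μ i - (l + 1)) + 1 := fun i => by ring
  rw [(htr _ fun i => (hl i).ne').1, (htr _ fun i => (hl' i).ne').1,
    (htr _ fun i => (hl' i).ne').2]
  simp_rw [e] at hsum ⊢
  exact ⟨(hpd _).2 hl', sub_pos.1 (sum_inv_sub_sum_inv_add_pos hx one_pos),
    mul_one_add_le_sum_inv_sq hx (hsum.trans ha.le)⟩

/-- One step of the Batson–Spielman–Srivastava construction. -/
theorem BetweenBarriers.exists_step [Nonempty m] {a l u : ℝ} {A : Matrix m m ℝ}
    (h : BetweenBarriers a l u A) (ha : 0 < a) (ha' : a ≤ 1 / 8) {v : ι → m → ℝ}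
    (hv : ∑ i, vecMulVec (v i) (v i) = 1) :
    ∃ i, ∃ t : ℝ, 0 ≤ t ∧
      BetweenBarriers a (l + 1) (u + (1 + 4 * a)) (A + t • vecMulVec (v i) (v i)) := by
  obtain ⟨hUpd, hUlt, hUle⟩ := h.upper_shift (δ := 1 + 4 * a) (by linarith)
  obtain ⟨hLpd, hLlt, hLle⟩ := h.lower_shift (by linarith)
  set NU := (u + (1 + 4 * a)) • 1 - A with hNU
  set NL := A - (l + 1) • 1 with hNL
  set gU := trace (u • 1 - A)⁻¹ - trace NU⁻¹ with hgU
  set gL := trace NL⁻¹ - trace (A - l • 1)⁻¹ with hgL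
  have hgU0 : 0 < gU := sub_pos.2 hUlt
  have hgL0 : 0 < gL := sub_pos.2 hLlt
  set Q : Matrix m m ℝ → ι → ℝ := fun B i => v i ⬝ᵥ B *ᵥ v i with hQ
  have hsum : ∀ B, ∑ i, Q B i = trace B := sum_dotProduct_mulVec hv
  -- Averaging: the left side sums to at most 1 / (1 + 4a) + a < 1 - a, the right side to at least 1
  -- - a.
  have hex : ∃ i ∈ Finset.univ, Q (NU⁻¹ * NU⁻¹) i / gU + Q NU⁻¹ i <
      Q (NL⁻¹ * NL⁻¹) i / gL - Q NL⁻¹ i := by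
    apply Finset.exists_lt_of_sum_lt
    rw [Finset.sum_add_distrib, Finset.sum_sub_distrib, ← Finset.sum_div, ← Finset.sum_div,
      hsum, hsum, hsum, hsum]
    have h1 : trace (NU⁻¹ * NU⁻¹) / gU ≤ 1 / (1 + 4 * a) := by
      rw [div_le_div_iff₀ hgU0 (by linarith)]; linarith
    have h2 : 1 + gL ≤ trace (NL⁻¹ * NL⁻¹) / gL := by
      rw [le_div_iff₀ hgL0]; linarith
    have h3 : 1 / (1 + 4 * a) < 1 - 2 * a := by
      rw [div_lt_iff₀ (by linarith)]; nlinarith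
    have := h.upper_trace
    have := h.lower_trace
    linarith
  obtain ⟨i, -, hi⟩ := hex
  have hU2 : 0 ≤ Q (NU⁻¹ * NU⁻¹) i := dotProduct_mulVec_nonneg (posSemidef_inv_mul_inv hUpd) _
  have hU1 : 0 ≤ Q NU⁻¹ i := dotProduct_mulVec_nonneg hUpd.inv.posSemidef _
  have hL1 : 0 ≤ Q NL⁻¹ i := dotProduct_mulVec_nonneg hLpd.inv.posSemidef _
  -- The weight 1 / r restores the lower trace exactly to its old value; `hi` ensures that the upper
  -- trace does not increase.
  set r := Q (NL⁻¹ * NL⁻¹) i / gL - Q NL⁻¹ i with hr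
  have hr0 : 0 < r := lt_of_le_of_lt (by positivity) hi
  have hU1r : Q NU⁻¹ i < r := lt_of_le_of_lt (by linarith [div_nonneg hU2 hgU0.le]) hi
  have hL2 : Q (NL⁻¹ * NL⁻¹) i = gL * (r + Q NL⁻¹ i) := by
    rw [hr]; field_simp; ring
  have hU2' : Q (NU⁻¹ * NU⁻¹) i ≤ gU * (r - Q NU⁻¹ i) := by
    have : Q (NU⁻¹ * NU⁻¹) i / gU ≤ r - Q NU⁻¹ i := by linarith
    rwa [div_le_iff₀ hgU0, mul_comm] at this
  have hposU : 0 < 1 + -(1 / r) * (v i ⬝ᵥ NU⁻¹ *ᵥ v i) := by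
    have : 1 + -(1 / r) * (v i ⬝ᵥ NU⁻¹ *ᵥ v i) = (r - Q NU⁻¹ i) / r := by
      rw [hQ]; field_simp; ring
    rw [this]
    exact div_pos (by linarith) hr0
  have hposL : 0 < 1 + (1 / r) * (v i ⬝ᵥ NL⁻¹ *ᵥ v i) := by
    have : 0 ≤ (1 / r) * (v i ⬝ᵥ NL⁻¹ *ᵥ v i) := mul_nonneg (by positivity) hL1
    linarith
  have eU : (u + (1 + 4 * a)) • 1 - (A + (1 / r) • vecMulVec (v i) (v i)) =
      NU + (-(1 / r)) • vecMulVec (v i) (v i) := by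
    rw [hNU, neg_smul]; abel
  have eL : A + (1 / r) • vecMulVec (v i) (v i) - (l + 1) • 1 =
      NL + (1 / r) • vecMulVec (v i) (v i) := by
    rw [hNL]; abel
  refine ⟨i, 1 / r, by positivity, ⟨?_, ?_, ?_, ?_, ?_⟩⟩
  · refine h.isHermitian.add ?_
    ext j k; simp [vecMulVec_apply, mul_comm]
  · rw [eU]; exact posDef_add_smul_vecMulVec hUpd _ hposU
  · rw [eL]; exact posDef_add_smul_vecMulVec hLpd _ hposL
  · rw [eU, trace_inv_add_smul_vecMulVec hUpd _ hposU]
    refine le_trans ?_ h.upper_trace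
    have key : 1 / r * (v i ⬝ᵥ (NU⁻¹ * NU⁻¹) *ᵥ v i) / (1 + -(1 / r) * (v i ⬝ᵥ NU⁻¹ *ᵥ v i)) ≤
        gU := by
      rw [div_le_iff₀ hposU]
      calc _ ≤ 1 / r * (gU * (r - Q NU⁻¹ i)) := by gcongr
        _ = _ := by rw [hQ]; field_simp; ring
    rw [neg_mul, neg_div]
    linarith
  · rw [eL, trace_inv_add_smul_vecMulVec hLpd _ hposL]
    refine le_trans (le_of_eq ?_) h.lower_trace
    have key : 1 / r * (v i ⬝ᵥ (NL⁻¹ * NL⁻¹) *ᵥ v i) / (1 + (1 / r) * (v i ⬝ᵥ NL⁻¹ *ᵥ v i)) =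
        gL := by
      rw [div_eq_iff hposL.ne']
      calc _ = 1 / r * (gL * (r + Q NL⁻¹ i)) := by rw [← hL2]
        _ = _ := by rw [hQ]; field_simp
    rw [key]
    linarith

theorem betweenBarriers_zero {a : ℝ} (ha : 0 < a) [Nonempty m] :
    BetweenBarriers a (-(Fintype.card m / a)) (Fintype.card m / a) (0 : Matrix m m ℝ) := by
  have hc : (0 : ℝ) < Fintype.card m := by exact_mod_cast Fintype.card_pos
  have hpd : (((Fintype.card m : ℝ) / a) • (1 : Matrix m m ℝ)).PosDef :=
    PosDef.one.smul (by positivity)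
  have htr : trace (((Fintype.card m : ℝ) / a) • (1 : Matrix m m ℝ))⁻¹ ≤ a := by
    rw [smul_one_eq_diagonal, inv_diagonal, trace_diagonal]
    have : IsUnit (fun _ : m => (Fintype.card m : ℝ) / a) := by
      rw [Pi.isUnit_iff]; intro _; exact (by positivity : (Fintype.card m : ℝ) / a ≠ 0).isUnit
    rw [Ring.inverse_of_isUnit this]
    simp
    field_simp
    rfl
  refine ⟨isHermitian_zero, ?_, ?_, ?_, ?_⟩
  · simpa using hpd
  · simpa [neg_smul] using hpd
  · simpa using htr
  · simpa [neg_smul] using htr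

theorem exists_betweenBarriers [Nonempty m] [DecidableEq ι] {a : ℝ} (ha : 0 < a) (ha' : a ≤ 1 / 8)
    {v : ι → m → ℝ} (hv : ∑ i, vecMulVec (v i) (v i) = 1) (k : ℕ) :
    ∃ s : ι → ℝ, (∀ i, 0 ≤ s i) ∧ {i | s i ≠ 0}.ncard ≤ k ∧
      BetweenBarriers a (-(Fintype.card m / a) + k) (Fintype.card m / a + k * (1 + 4 * a))
        (∑ i, s i • vecMulVec (v i) (v i)) := by
  induction k with
  | zero => exact ⟨0, by simp, by simp, by simpa using betweenBarriers_zero ha⟩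
  | succ k ih =>
    obtain ⟨s, hs, hcard, hb⟩ := ih
    obtain ⟨i, t, ht, hstep⟩ := hb.exists_step ha ha' hv
    refine ⟨s + Pi.single i t, fun j => ?_, ?_, ?_⟩
    · by_cases hj : j = i
      · subst hj; simpa using add_nonneg (hs j) ht
      · simpa [hj] using hs j
    · calc {j | (s + Pi.single i t : ι → ℝ) j ≠ 0}.ncard
          ≤ (insert i {j | s j ≠ 0}).ncard := by
            refine Set.ncard_le_ncard (fun j hj => ?_) (Set.toFinite _)
            by_cases hji : j = i
            · exact Or.inl hji
            · right; simpa [hji] using hj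
        _ ≤ k + 1 := (Set.ncard_insert_le _ _).trans (by omega)
    · convert hstep using 1
      · push_cast; ring
      · push_cast; ring
      · simp [add_smul, Finset.sum_add_distrib, Pi.single_apply]

/-- Linear-sized spectral sparsification of a decomposition of the identity. -/
theorem exists_sparsifier_one [Nonempty m] [DecidableEq ι] {ε : ℝ} (hε : 0 < ε) (hε' : ε ≤ 1)
    {v : ι → m → ℝ} (hv : ∑ i, vecMulVec (v i) (v i) = 1) :
    ∃ s : ι → ℝ, (∀ i, 0 ≤ s i) ∧
      ({i | s i ≠ 0}.ncard : ℝ) ≤ 128 * Fintype.card m / ε ^ 2 ∧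
      (Real.exp ε • 1 - ∑ i, s i • vecMulVec (v i) (v i)).PosSemidef ∧
      (∑ i, s i • vecMulVec (v i) (v i) - Real.exp (-ε) • 1).PosSemidef := by
  set N : ℝ := (Fintype.card m : ℝ) with hN
  have hN1 : 1 ≤ N := by
    rw [hN, Nat.one_le_cast]; exact Fintype.card_pos
  -- With T ≥ N / a^2 steps the initial offset N / a is at most a T. After division by T the
  -- spectrum lies between 1 - a and 1 + 5a, inside [exp (-ε), exp ε].
  set a := ε / 8 with ha
  have ha0 : 0 < a := by positivity
  set T : ℕ := ⌈N / a ^ 2⌉₊ with hT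
  have hT1 : N / a ^ 2 ≤ T := Nat.le_ceil _
  have hT0 : (0 : ℝ) < T := lt_of_lt_of_le (by positivity) hT1
  have hT2 : (T : ℝ) ≤ 128 * N / ε ^ 2 := by
    have h1 : (T : ℝ) < N / a ^ 2 + 1 := Nat.ceil_lt_add_one (by positivity)
    have h2 : N / a ^ 2 = 64 * (N / ε ^ 2) := by rw [ha]; field_simp; norm_num
    have h3 : 1 ≤ N / ε ^ 2 := by
      rw [le_div_iff₀ (by positivity)]; nlinarith
    rw [mul_div_assoc]; linarith
  have hT3 : N / a ≤ a * T := by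
    have : N / a = a * (N / a ^ 2) := by field_simp
    rw [this]; gcongr
  obtain ⟨s, hs, hcard, hb⟩ := exists_betweenBarriers ha0 (by linarith) hv T
  set B := ∑ i, s i • vecMulVec (v i) (v i) with hB
  have hexp1 : 1 + ε ≤ Real.exp ε := by linarith [Real.add_one_le_exp ε]
  have hexp2 : Real.exp (-ε) ≤ 1 - ε / 2 := by
    rw [Real.exp_neg]
    calc (Real.exp ε)⁻¹ ≤ (1 + ε)⁻¹ := by gcongr
      _ ≤ 1 - ε / 2 := by
        rw [inv_le_iff_one_le_mul₀ (by positivity)]; nlinarith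
  refine ⟨fun i => (T : ℝ)⁻¹ * s i, fun i => by have := hs i; positivity, ?_, ?_, ?_⟩
  · refine le_trans ?_ hT2
    have : {i | (T : ℝ)⁻¹ * s i ≠ 0} = {i | s i ≠ 0} := by
      ext i; simp [hT0.ne']
    rw [this]
    exact_mod_cast hcard
  all_goals
    simp_rw [mul_smul]
    rw [← Finset.smul_sum, ← hB]
  · have e : Real.exp ε • (1 : Matrix m m ℝ) - (T : ℝ)⁻¹ • B =
        (T : ℝ)⁻¹ • ((N / a + T * (1 + 4 * a)) • 1 - B) +
          (Real.exp ε - (T : ℝ)⁻¹ * (N / a + T * (1 + 4 * a))) • 1 := by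
      rw [smul_sub, smul_smul, sub_smul]; abel
    rw [e]
    refine (hb.upper_posDef.posSemidef.smul (by positivity)).add (PosSemidef.one.smul ?_)
    have : (T : ℝ)⁻¹ * (N / a + T * (1 + 4 * a)) ≤ 1 + 5 * a := by
      rw [inv_mul_le_iff₀ hT0]; linarith
    linarith
  · have e : (T : ℝ)⁻¹ • B - Real.exp (-ε) • (1 : Matrix m m ℝ) =
        (T : ℝ)⁻¹ • (B - (-(N / a) + T) • 1) +
          ((T : ℝ)⁻¹ * (-(N / a) + T) - Real.exp (-ε)) • 1 := by
      rw [smul_sub, smul_smul, sub_smul]; abel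
    rw [e]
    refine (hb.lower_posDef.posSemidef.smul (by positivity)).add (PosSemidef.one.smul ?_)
    have : 1 - a ≤ (T : ℝ)⁻¹ * (-(N / a) + T) := by
      rw [le_inv_mul_iff₀ hT0]; linarith
    linarith

end Step

/-! ### Structure-preserving sparsification of positive definite matrices. -/

section Sparsify

variable {ι m : Type*} [Fintype ι] [Fintype m] [DecidableEq m]

open scoped MatrixOrder in
/-- Linear-sized spectral sparsification of a decomposition of a positive definite matrix. -/
theorem exists_sparsifier [Nonempty m] [DecidableEq ι] {ε : ℝ} (hε : 0 < ε) (hε' : ε ≤ 1)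
    {M : Matrix m m ℝ} (hM : M.PosDef) {v : ι → m → ℝ}
    (hv : ∑ i, vecMulVec (v i) (v i) = M) :
    ∃ s : ι → ℝ, (∀ i, 0 ≤ s i) ∧
      ({i | s i ≠ 0}.ncard : ℝ) ≤ 128 * Fintype.card m / ε ^ 2 ∧
      (Real.exp ε • M - ∑ i, s i • vecMulVec (v i) (v i)).PosSemidef ∧
      (∑ i, s i • vecMulVec (v i) (v i) - Real.exp (-ε) • M).PosSemidef := by
  -- Factoring `M` as `Bᴴ * B` and transforming the vectors by `B⁻¹` reduces to the identity;
  -- congruence by `B` transports the bounds back.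
  obtain ⟨B, hB, hMB⟩ :=
    CStarAlgebra.isStrictlyPositive_iff_eq_star_mul_self.mp hM.isStrictlyPositive
  rw [star_eq_conjTranspose] at hMB
  have hdet := (isUnit_iff_isUnit_det B).1 hB
  set w : ι → m → ℝ := fun i => v i ᵥ* B⁻¹ with hw
  have hww : ∀ i, vecMulVec (w i) (w i) = (B⁻¹)ᴴ * vecMulVec (v i) (v i) * B⁻¹ := by
    intro i
    rw [mul_vecMulVec, vecMulVec_mul, hw, conjTranspose_eq_transpose_of_trivial, mulVec_transpose]
  have h1 : (B⁻¹)ᴴ * Bᴴ = 1 := by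
    rw [← conjTranspose_mul, mul_nonsing_inv _ hdet, conjTranspose_one]
  have h2 : Bᴴ * (B⁻¹)ᴴ = 1 := by
    rw [← conjTranspose_mul, nonsing_inv_mul _ hdet, conjTranspose_one]
  have hsum : ∑ i, vecMulVec (w i) (w i) = 1 := by
    simp_rw [hww]
    rw [← Finset.sum_mul, ← Finset.mul_sum, hv, hMB, ← mul_assoc, h1, one_mul,
      mul_nonsing_inv _ hdet]
  obtain ⟨s, hs, hcard, hup, hlo⟩ := exists_sparsifier_one hε hε' hsum
  have hconj : Bᴴ * (∑ i, s i • vecMulVec (w i) (w i)) * B =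
      ∑ i, s i • vecMulVec (v i) (v i) := by
    rw [Finset.mul_sum, Finset.sum_mul]
    refine Finset.sum_congr rfl fun i _ => ?_
    rw [hww, mul_smul_comm, smul_mul_assoc]
    congr 1
    calc Bᴴ * ((B⁻¹)ᴴ * vecMulVec (v i) (v i) * B⁻¹) * B
        = (Bᴴ * (B⁻¹)ᴴ) * vecMulVec (v i) (v i) * (B⁻¹ * B) := by simp only [mul_assoc]
      _ = _ := by rw [h2, nonsing_inv_mul _ hdet, one_mul, mul_one]
  refine ⟨s, hs, hcard, ?_, ?_⟩
  · have := hup.conjTranspose_mul_mul_same B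
    rwa [mul_sub, sub_mul, hconj, mul_smul_comm, mul_one, smul_mul_assoc, ← hMB] at this
  · have := hlo.conjTranspose_mul_mul_same B
    rwa [mul_sub, sub_mul, hconj, mul_smul_comm, mul_one, smul_mul_assoc, ← hMB] at this

/-- The vector of the edge `(i, j)`, or of the loop at `i` if `i = j`. -/
def edgeVec (p : m × m) : m → ℝ :=
  if p.1 = p.2 then Pi.single p.1 1 else Pi.single p.1 1 - Pi.single p.2 1

/-- The matrix of the quadratic form with weight `c (i, j)` on the edge `(i, j)` and weight
`c (i, i)` on the loop at `i`. -/
def edgeMatrix (c : m × m → ℝ) : Matrix m m ℝ :=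
  ∑ p, c p • vecMulVec (edgeVec p) (edgeVec p)

theorem edgeMatrix_isSymm (c : m × m → ℝ) : (edgeMatrix c).IsSymm := by
  rw [IsSymm, edgeMatrix, transpose_sum]
  simp [transpose_smul, transpose_vecMulVec]

theorem edgeMatrix_apply_of_ne (c : m × m → ℝ) {k l : m} (h : k ≠ l) :
    edgeMatrix c k l = -(c (k, l) + c (l, k)) := by
  have hp : ∀ p : m × m, edgeVec p k * edgeVec p l =
      -((if p = (k, l) then 1 else 0) + if p = (l, k) then 1 else 0) := by
    rintro ⟨i, j⟩
    by_cases hij : i = j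
    · subst hij
      have h1 : ¬((i = k) ∧ (i = l)) := by rintro ⟨rfl, rfl⟩; exact h rfl
      have h2 : ¬((i = l) ∧ (i = k)) := by rintro ⟨rfl, rfl⟩; exact h rfl
      simp only [edgeVec, if_true, Pi.single_apply, Prod.mk.injEq, h1, h2, if_false]
      grind
    · simp only [edgeVec, hij, if_false, Pi.sub_apply, Pi.single_apply, Prod.mk.injEq]
      grind
  rw [edgeMatrix, Matrix.sum_apply]
  simp only [Matrix.smul_apply, vecMulVec_apply, smul_eq_mul, hp, mul_neg, mul_add, mul_ite, mul_one,
    mul_zero, Finset.sum_neg_distrib, Finset.sum_add_distrib, Finset.sum_ite_eq',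
    Finset.mem_univ, if_true]

/-- Edge vectors are orthogonal to the all-ones vector, so only loops contribute. -/
theorem sum_edgeMatrix (c : m × m → ℝ) (k : m) : ∑ l, edgeMatrix c k l = c (k, k) := by
  have hsum : ∀ p : m × m, ∑ l, edgeVec p l = if p.1 = p.2 then 1 else 0 := by
    intro p
    by_cases h : p.1 = p.2
    · simp [edgeVec, h]
    · simp [edgeVec, h, Finset.sum_sub_distrib]
  have hp : ∀ p : m × m, edgeVec p k * ∑ l, edgeVec p l = if p = (k, k) then 1 else 0 := by
    rintro ⟨i, j⟩
    rw [hsum]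
    by_cases h : i = j
    · subst h; simp [edgeVec, Pi.single_apply, eq_comm]
    · simp [h]; rintro rfl; exact fun h' => h h'.symm
  calc ∑ l, edgeMatrix c k l = ∑ p, c p * (edgeVec p k * ∑ l, edgeVec p l) := by
        simp only [edgeMatrix, Matrix.sum_apply, Matrix.smul_apply, vecMulVec_apply, smul_eq_mul]
        rw [Finset.sum_comm]
        simp [Finset.mul_sum]
    _ = _ := by simp [hp]

theorem eq_of_offDiag_of_sum {M N : Matrix m m ℝ} (h : ∀ k l, k ≠ l → M k l = N k l)
    (hs : ∀ k, ∑ l, M k l = ∑ l, N k l) : M = N := by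
  ext k l
  by_cases hkl : k = l
  · subst hkl
    have := hs k
    rw [← Finset.add_sum_erase _ _ (Finset.mem_univ k),
      ← Finset.add_sum_erase (a := k) _ (N k) (Finset.mem_univ k),
      Finset.sum_congr rfl fun j hj => h k j (Finset.ne_of_mem_erase hj).symm] at this
    linarith
  · exact h k l hkl

/-- Linear-sized spectral sparsification within the class of symmetric matrices with nonpositive
off-diagonal entries and nonnegative row sums. -/
theorem exists_sparse_approx {n : ℕ} [NeZero n] {ε : ℝ} (hε : 0 < ε) (hε' : ε ≤ 1)
    {M : Matrix (Fin n) (Fin n) ℝ} (hM : M.PosDef) (hoff : ∀ i j, i ≠ j → M i j ≤ 0)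
    (hrow : ∀ i, 0 ≤ ∑ j, M i j) :
    ∃ N : Matrix (Fin n) (Fin n) ℝ, N.IsSymm ∧ (∀ i j, i ≠ j → N i j ≤ 0) ∧
      (∀ i, 0 ≤ ∑ j, N i j) ∧
      ({p : Fin n × Fin n | p.1 ≠ p.2 ∧ N p.1 p.2 ≠ 0}.ncard : ℝ) ≤ 256 * n / ε ^ 2 ∧
      Approx ε M N := by
  have hsymm : ∀ i j, M i j = M j i := fun i j => by
    simpa using (congrFun (congrFun hM.1.eq j) i)
  -- Each edge occurs as two ordered pairs, hence the half; the loop carries the row's slack in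
  -- diagonal dominance.
  set c : Fin n × Fin n → ℝ := fun p =>
    if p.1 = p.2 then ∑ j, M p.1 j else -M p.1 p.2 / 2 with hc
  have hc0 : ∀ p, 0 ≤ c p := by
    rintro ⟨i, j⟩
    by_cases h : i = j
    · simpa [hc, h] using hrow j
    · simpa [hc, h] using (div_nonneg (neg_nonneg.2 (hoff i j h)) zero_le_two)
  have hcM : edgeMatrix c = M := by
    refine eq_of_offDiag_of_sum (fun k l h => ?_) fun k => ?_
    · rw [edgeMatrix_apply_of_ne c h]
      simp only [hc, h, h.symm, if_false, hsymm l k]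
      ring
    · rw [sum_edgeMatrix]; simp [hc]
  set v : Fin n × Fin n → Fin n → ℝ := fun p => Real.sqrt (c p) • edgeVec p with hv
  have hvv : ∀ p, vecMulVec (v p) (v p) = c p • vecMulVec (edgeVec p) (edgeVec p) := by
    intro p
    rw [hv, smul_vecMulVec, vecMulVec_smul, smul_smul, Real.mul_self_sqrt (hc0 p)]
  obtain ⟨s, hs, hcard, hup, hlo⟩ := exists_sparsifier hε hε' hM (v := v) (by
    simp_rw [hvv]; exact hcM)
  set c' : Fin n × Fin n → ℝ := fun p => s p * c p with hc'
  have hc'0 : ∀ p, 0 ≤ c' p := fun p => mul_nonneg (hs p) (hc0 p)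
  have hN : ∑ p, s p • vecMulVec (v p) (v p) = edgeMatrix c' := by
    simp_rw [hvv, smul_smul]; rfl
  rw [hN] at hup hlo
  refine ⟨edgeMatrix c', edgeMatrix_isSymm _, fun i j h => ?_, fun i => ?_, ?_, hup, hlo⟩
  · rw [edgeMatrix_apply_of_ne _ h]
    linarith [hc'0 (i, j), hc'0 (j, i)]
  · rw [sum_edgeMatrix]; exact hc'0 _
  · set S := {p | s p ≠ 0} with hS
    have hsub : {p : Fin n × Fin n | p.1 ≠ p.2 ∧ edgeMatrix c' p.1 p.2 ≠ 0} ⊆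
        S ∪ Prod.swap '' S := by
      rintro ⟨i, j⟩ ⟨hij, hne⟩
      rw [edgeMatrix_apply_of_ne _ hij] at hne
      by_contra hcon
      simp only [Set.mem_union, Set.mem_image, not_or, not_exists, not_and, hS,
        Set.mem_ofPred_eq, not_not] at hcon
      have h1 : s (i, j) = 0 := hcon.1
      have h2 : s (j, i) = 0 := by
        by_contra h
        exact hcon.2 (j, i) h rfl
      exact hne (by simp [hc', h1, h2])
    have h1 : {p : Fin n × Fin n | p.1 ≠ p.2 ∧ edgeMatrix c' p.1 p.2 ≠ 0}.ncard ≤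
        S.ncard + S.ncard :=
      (Set.ncard_le_ncard hsub (Set.toFinite _)).trans <| (Set.ncard_union_le _ _).trans <| by
        exact Nat.add_le_add_left (Set.ncard_image_le (Set.toFinite _)) _
    have h2 : ({p : Fin n × Fin n | p.1 ≠ p.2 ∧ edgeMatrix c' p.1 p.2 ≠ 0}.ncard : ℝ) ≤
        S.ncard + S.ncard := by exact_mod_cast h1
    rw [Fintype.card_fin] at hcard
    calc _ ≤ _ := h2
      _ ≤ 128 * n / ε ^ 2 + 128 * n / ε ^ 2 := by gcongr
      _ = _ := by ring

end Sparsify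

/-! ### Squaring, growth of the gap, and one level of the chain. -/

section Chain

variable {n : ℕ}

theorem Approx.symm {ε : ℝ} {X Y : Matrix (Fin n) (Fin n) ℝ} (h : Approx ε X Y) :
    Approx ε Y X := by
  constructor
  · have := h.2.smul (Real.exp_pos ε).le
    rwa [smul_sub, smul_smul, ← Real.exp_add, add_neg_cancel, Real.exp_zero, one_smul] at this
  · have := h.1.smul (Real.exp_pos (-ε)).le
    rwa [smul_sub, smul_smul, ← Real.exp_add, neg_add_cancel, Real.exp_zero, one_smul] at this

/-- The pair `D`, `A` represents `D - A` with `D` diagonal and positive, `A` entrywise nonnegative,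
nonnegative row sums, and `D - A ≽ lam • D`. -/
structure IsDominantPair (lam : ℝ) (D A : Matrix (Fin n) (Fin n) ℝ) : Prop where
  isDiag : D.IsDiag
  diag_pos : ∀ i, 0 < D i i
  symm : A.IsSymm
  nonneg : EntrywiseNonneg A
  row_sum : ∀ i, ∑ j, A i j ≤ D i i
  gap : (D - A - lam • D).PosSemidef

namespace IsDominantPair

variable {lam : ℝ} {D A : Matrix (Fin n) (Fin n) ℝ}

theorem eq_diagonal (h : IsDominantPair lam D A) : D = diagonal fun i => D i i :=
  h.isDiag.diagonal_diag.symm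

theorem posDef_diag (h : IsDominantPair lam D A) : D.PosDef := by
  rw [h.eq_diagonal]
  exact PosDef.diagonal h.diag_pos

theorem posDef (h : IsDominantPair lam D A) (hlam : 0 < lam) : (D - A).PosDef := by
  have := (h.posDef_diag.smul hlam).posSemidef_add h.gap
  rwa [sub_add_cancel] at this

theorem mono (h : IsDominantPair lam D A) {lam' : ℝ} (hle : lam' ≤ lam) :
    IsDominantPair lam' D A := by
  refine { h with gap := ?_ }
  have := h.gap.add (h.posDef_diag.posSemidef.smul (sub_nonneg.2 hle))
  rwa [sub_smul, sub_add_sub_cancel] at this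

theorem dotProduct_le (h : IsDominantPair lam D A) (x : Fin n → ℝ) :
    x ⬝ᵥ A *ᵥ x ≤ (1 - lam) * (x ⬝ᵥ D *ᵥ x) := by
  have := dotProduct_mulVec_nonneg h.gap x
  rw [sub_mulVec, sub_mulVec, smul_mulVec, dotProduct_sub, dotProduct_sub, dotProduct_smul,
    smul_eq_mul] at this
  linarith

/-- As `A` is entrywise nonnegative, its top eigenvalue relative to `D` dominates. -/
theorem neg_dotProduct_le (h : IsDominantPair lam D A) (x : Fin n → ℝ) :
    -(x ⬝ᵥ A *ᵥ x) ≤ (1 - lam) * (x ⬝ᵥ D *ᵥ x) := by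
  have h1 := h.dotProduct_le fun i => |x i|
  have h2 : (fun i => |x i|) ⬝ᵥ D *ᵥ (fun i => |x i|) = x ⬝ᵥ D *ᵥ x := by
    rw [h.eq_diagonal]
    simp only [dotProduct, mulVec_diagonal]
    refine Finset.sum_congr rfl fun i _ => ?_
    linear_combination D i i * abs_mul_abs_self (x i)
  rw [h2] at h1
  refine le_trans ?_ h1
  simp only [dotProduct, mulVec, Finset.mul_sum]
  simp only [← Finset.sum_neg_distrib]
  refine Finset.sum_le_sum fun i _ => Finset.sum_le_sum fun j _ => ?_
  have h3 : -(x i * x j) ≤ |x i| * |x j| := by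
    rw [← abs_mul]; exact neg_le_abs _
  nlinarith [mul_le_mul_of_nonneg_left h3 (h.nonneg i j)]

/-- Polarization: the upper bound at `x + y` plus the lower bound at `x - y`. It expresses the
relative spectral bound without square roots of `D`. -/
theorem two_mul_dotProduct_le (h : IsDominantPair lam D A) (x y : Fin n → ℝ) :
    2 * (x ⬝ᵥ A *ᵥ y) ≤ (1 - lam) * (x ⬝ᵥ D *ᵥ x + y ⬝ᵥ D *ᵥ y) := by
  have h1 := h.dotProduct_le (x + y)
  have h2 := h.neg_dotProduct_le (x - y)
  have hA : y ⬝ᵥ A *ᵥ x = x ⬝ᵥ A *ᵥ y := by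
    rw [dotProduct_mulVec, ← mulVec_transpose, h.symm.eq, dotProduct_comm]
  simp only [mulVec_add, mulVec_sub, dotProduct_add, dotProduct_sub, add_dotProduct,
    sub_dotProduct, hA] at h1 h2
  linarith

theorem isHermitian_mul_inv_mul (h : IsDominantPair lam D A) :
    (D - A * D⁻¹ * A).IsHermitian := by
  have hD := h.posDef_diag.1
  have hDi := h.posDef_diag.inv.1
  have hA : Aᴴ = A := h.symm.eq
  refine hD.sub ?_
  rw [IsHermitian, conjTranspose_mul, conjTranspose_mul, hDi.eq, hA, mul_assoc]

/-- The new gap is 1 - (1 - lam)^2 = 2 lam - lam^2, which is at least 3/2 lam because lam ≤ 1/2. -/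
theorem gap_mul_inv_mul (h : IsDominantPair lam D A) (h0 : 0 ≤ lam) (h1 : lam ≤ 1 / 2) :
    (D - A * D⁻¹ * A - (3 / 2 * lam) • D).PosSemidef := by
  refine .of_dotProduct_mulVec_nonneg
    (h.isHermitian_mul_inv_mul.sub (h.posDef_diag.posSemidef.smul (by positivity)).1) fun x => ?_
  set y := D⁻¹ *ᵥ (A *ᵥ x) with hy
  have hDy : D *ᵥ y = A *ᵥ x := by
    rw [hy, mulVec_mulVec, mul_nonsing_inv _ ((isUnit_iff_isUnit_det D).1 h.posDef_diag.isUnit),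
      one_mulVec]
  have hxy : y ⬝ᵥ A *ᵥ x = x ⬝ᵥ A *ᵥ y := by
    rw [dotProduct_mulVec, ← mulVec_transpose, h.symm.eq, dotProduct_comm]
  have hθ : 0 < 1 - lam := by linarith
  have key := h.two_mul_dotProduct_le x ((1 - lam)⁻¹ • y)
  rw [mulVec_smul, mulVec_smul, dotProduct_smul, dotProduct_smul, smul_dotProduct, hDy, hxy] at key
  simp only [smul_eq_mul] at key
  have e : star x ⬝ᵥ (D - A * D⁻¹ * A - (3 / 2 * lam) • D) *ᵥ x =
      x ⬝ᵥ D *ᵥ x - x ⬝ᵥ A *ᵥ y - 3 / 2 * lam * (x ⬝ᵥ D *ᵥ x) := by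
    rw [star_trivial, sub_mulVec, sub_mulVec, smul_mulVec, dotProduct_sub, dotProduct_sub,
      dotProduct_smul, ← mulVec_mulVec, ← mulVec_mulVec, smul_eq_mul]
  rw [e]
  have hp := dotProduct_mulVec_nonneg h.posDef_diag.posSemidef x
  set p := x ⬝ᵥ D *ᵥ x
  set q := x ⬝ᵥ A *ᵥ y
  have hq : q ≤ (1 - lam) ^ 2 * p := by
    have h2 : (1 - lam) * (2 * ((1 - lam)⁻¹ * q)) ≤
        (1 - lam) * ((1 - lam) * (p + (1 - lam)⁻¹ * ((1 - lam)⁻¹ * q))) :=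
      mul_le_mul_of_nonneg_left key hθ.le
    have h3 : (1 - lam) * (2 * ((1 - lam)⁻¹ * q)) = 2 * q := by field_simp
    have h4 : (1 - lam) * ((1 - lam) * (p + (1 - lam)⁻¹ * ((1 - lam)⁻¹ * q))) =
        (1 - lam) ^ 2 * p + q := by field_simp
    linarith
  nlinarith [mul_nonneg (mul_nonneg h0 (by linarith : (0 : ℝ) ≤ 1 / 2 - lam)) hp]

theorem mul_inv_mul_apply (h : IsDominantPair lam D A) (i j : Fin n) :
    (A * D⁻¹ * A) i j = ∑ k, A i k * (D k k)⁻¹ * A k j := by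
  have : D⁻¹ = diagonal fun i => (D i i)⁻¹ := by
    apply inv_eq_right_inv
    conv_lhs => rw [h.eq_diagonal]
    rw [diagonal_mul_diagonal, ← diagonal_one]
    congr 1
    ext k
    simp [(h.diag_pos k).ne']
  rw [this, mul_apply]
  simp [mul_diagonal]

theorem mul_inv_mul_nonneg (h : IsDominantPair lam D A) : EntrywiseNonneg (A * D⁻¹ * A) := by
  intro i j
  rw [h.mul_inv_mul_apply]
  exact Finset.sum_nonneg fun k _ =>
    mul_nonneg (mul_nonneg (h.nonneg i k) (inv_pos.2 (h.diag_pos k)).le) (h.nonneg k j)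

theorem sum_diag (h : IsDominantPair lam D A) (i : Fin n) : ∑ j, D i j = D i i :=
  Finset.sum_eq_single i (fun j _ hj => h.isDiag hj.symm) (by simp)

/-- `D⁻¹ * A` is substochastic, so `A * D⁻¹ * A` has row sums no larger than those of `A`. -/
theorem row_sum_mul_inv_mul (h : IsDominantPair lam D A) (i : Fin n) :
    0 ≤ ∑ j, (D - A * D⁻¹ * A) i j := by
  simp only [Matrix.sub_apply, Finset.sum_sub_distrib, h.mul_inv_mul_apply]
  rw [h.sum_diag, Finset.sum_comm, sub_nonneg]
  refine le_trans (Finset.sum_le_sum fun k _ => ?_) (h.row_sum i)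
  rw [← Finset.mul_sum]
  have hk := h.diag_pos k
  calc A i k * (D k k)⁻¹ * ∑ j, A k j ≤ A i k * (D k k)⁻¹ * D k k := by
        have := h.nonneg i k
        gcongr
        exact h.row_sum k
    _ = A i k := by field_simp

theorem nnz_diag_le {D : Matrix (Fin n) (Fin n) ℝ} (h : D.IsDiag) : nnz D ≤ n := by
  have hsub : {p : Fin n × Fin n | D p.1 p.2 ≠ 0} ⊆ Set.range fun i : Fin n => (i, i) := by
    rintro ⟨i, j⟩ hij
    by_cases he : i = j
    · exact ⟨i, by simp [he]⟩
    · exact absurd (h he) hij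
  calc nnz D ≤ (Set.range fun i : Fin n => (i, i)).ncard :=
        Set.ncard_le_ncard hsub (Set.toFinite _)
    _ ≤ n := by
        rw [← Set.image_univ]
        exact (Set.ncard_image_le (Set.toFinite _)).trans (by simp)

theorem nnz_le (M : Matrix (Fin n) (Fin n) ℝ) :
    nnz M ≤ n + {p : Fin n × Fin n | p.1 ≠ p.2 ∧ M p.1 p.2 ≠ 0}.ncard := by
  have hsub : {p : Fin n × Fin n | M p.1 p.2 ≠ 0} ⊆ (Set.range fun i : Fin n => (i, i)) ∪
      {p : Fin n × Fin n | p.1 ≠ p.2 ∧ M p.1 p.2 ≠ 0} := by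
    rintro ⟨i, j⟩ hij
    by_cases he : i = j
    · exact Or.inl ⟨i, by simp [he]⟩
    · exact Or.inr ⟨he, hij⟩
  refine (Set.ncard_le_ncard hsub (Set.toFinite _)).trans ((Set.ncard_union_le _ _).trans ?_)
  refine Nat.add_le_add_right ?_ _
  rw [← Set.image_univ]
  exact (Set.ncard_image_le (Set.toFinite _)).trans (by simp)

/-- One level of the chain: square, then sparsify. -/
theorem exists_next [NeZero n] (h : IsDominantPair lam D A) (h0 : 0 < lam) (h1 : lam ≤ 1 / 2)
    {ε : ℝ} (hε : 0 < ε) (hε' : ε ≤ 1) :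
    ∃ D' A' : Matrix (Fin n) (Fin n) ℝ,
      IsDominantPair (Real.exp (-(2 * ε)) * (3 / 2 * lam)) D' A' ∧
      Approx ε (D' - A') (D - A * D⁻¹ * A) ∧ Approx ε D' D ∧
      (nnz D' : ℝ) ≤ n ∧ (nnz A' : ℝ) ≤ n + 256 * n / ε ^ 2 := by
  set K := D - A * D⁻¹ * A with hK
  have hgap := h.gap_mul_inv_mul h0.le h1
  have hKpd : K.PosDef := by
    have := (h.posDef_diag.smul (by positivity : 0 < 3 / 2 * lam)).posSemidef_add hgap
    rwa [sub_add_cancel] at this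
  have hKoff : ∀ i j, i ≠ j → K i j ≤ 0 := fun i j hij => by
    rw [hK, Matrix.sub_apply, h.isDiag hij, zero_sub, neg_nonpos]
    exact h.mul_inv_mul_nonneg i j
  obtain ⟨N, hNs, hNoff, hNrow, hNcard, hNK⟩ :=
    exists_sparse_approx hε hε' hKpd hKoff h.row_sum_mul_inv_mul
  have hexp := Real.exp_pos ε
  have hoff : ∀ i j, i ≠ j → (Real.exp ε • D - N) i j = -N i j := fun i j hij => by
    simp [h.isDiag hij]
  -- Inflating `D` by exp ε keeps the diagonal of the new `A` nonnegative, since N ≼ exp ε • K and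
  -- the diagonal of K is at most that of `D`.
  refine ⟨Real.exp ε • D, Real.exp ε • D - N, ⟨?_, ?_, ?_, ?_, ?_, ?_⟩, ?_, ⟨?_, ?_⟩, ?_, ?_⟩
  · exact h.isDiag.smul _
  · intro i
    simpa using mul_pos hexp (h.diag_pos i)
  · exact (h.isDiag.isSymm.smul _).sub hNs
  · intro i j
    by_cases hij : i = j
    · subst hij
      have h2 := hNK.1.diag_nonneg (i := i)
      have h3 := mul_nonneg hexp.le (h.mul_inv_mul_nonneg i i)
      simp only [hK, Matrix.sub_apply, Matrix.smul_apply, smul_eq_mul] at h2 ⊢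
      linarith
    · rw [hoff i j hij, neg_nonneg]
      exact hNoff i j hij
  · intro i
    simp only [Matrix.sub_apply, Matrix.smul_apply, smul_eq_mul, Finset.sum_sub_distrib,
      ← Finset.mul_sum, h.sum_diag]
    linarith [hNrow i]
  · rw [sub_sub_cancel, smul_smul]
    -- One factor exp (-ε) is lost in comparing N with K, the other in measuring against the
    -- inflated diagonal.
    have e : Real.exp (-(2 * ε)) * (3 / 2 * lam) * Real.exp ε =
        Real.exp (-ε) * (3 / 2 * lam) := by
      rw [mul_right_comm, ← Real.exp_add]
      congr 2
      ring
    rw [e]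
    have := hNK.2.add (hgap.smul (Real.exp_pos (-ε)).le)
    rwa [smul_sub _ K, smul_smul, sub_add_sub_cancel] at this
  · rw [sub_sub_cancel]
    exact hNK.symm
  · rw [smul_smul, show (Real.exp ε * Real.exp ε) • D - D =
      (Real.exp ε * Real.exp ε - 1) • D by rw [sub_smul, one_smul]]
    refine h.posDef_diag.posSemidef.smul ?_
    nlinarith [Real.one_le_exp hε.le]
  · rw [smul_smul, ← Real.exp_add, neg_add_cancel, Real.exp_zero, one_smul, sub_self]
    exact .zero
  · exact_mod_cast nnz_diag_le (h.isDiag.smul (Real.exp ε))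
  · have h2 := nnz_le (Real.exp ε • D - N)
    have h3 : {p : Fin n × Fin n | p.1 ≠ p.2 ∧ (Real.exp ε • D - N) p.1 p.2 ≠ 0} =
        {p : Fin n × Fin n | p.1 ≠ p.2 ∧ N p.1 p.2 ≠ 0} := by
      ext ⟨i, j⟩
      simp only [Set.mem_ofPred_eq]
      refine and_congr_right fun hij => ?_
      rw [hoff i j hij, neg_ne_zero]
    rw [h3] at h2
    have h4 : (nnz (Real.exp ε • D - N) : ℝ) ≤
        n + {p : Fin n × Fin n | p.1 ≠ p.2 ∧ N p.1 p.2 ≠ 0}.ncard := by exact_mod_cast h2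
    linarith

theorem approx_diag (h : IsDominantPair lam D A) {ε : ℝ} (h1 : Real.exp (-ε) ≤ lam)
    (h2 : 2 - lam ≤ Real.exp ε) : Approx ε D (D - A) := by
  refine ⟨?_, ?_⟩
  · refine .of_dotProduct_mulVec_nonneg ((h.posDef_diag.smul (Real.exp_pos ε)).1.sub
      (h.posDef_diag.1.sub h.symm.eq)) fun x => ?_
    have h3 := h.neg_dotProduct_le x
    have h4 := dotProduct_mulVec_nonneg h.posDef_diag.posSemidef x
    rw [star_trivial, sub_mulVec, sub_mulVec, smul_mulVec, dotProduct_sub, dotProduct_sub,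
      dotProduct_smul, smul_eq_mul]
    nlinarith
  · exact (h.mono h1).gap

end IsDominantPair

end Chain

/-! ### From condition number to gap, and assembly of the chain. -/

section Main

variable {n : ℕ}

open scoped MatrixOrder in
-- Diagonal entries never exceed the largest eigenvalue. This converts the condition number into a
-- gap relative to `D`.
theorem condNumber_spec [NeZero n] {M : Matrix (Fin n) (Fin n) ℝ} (hM : M.PosDef) :
    1 ≤ condNumber M ∧ ∀ i, ((condNumber M)⁻¹ * M i i) • (1 : Matrix (Fin n) (Fin n) ℝ) ≤ M := by
  have hspec : spectrum ℝ M = Set.range hM.1.eigenvalues := hM.1.spectrum_real_eq_range_eigenvalues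
  have hfin : (spectrum ℝ M).Finite := hspec ▸ Set.finite_range _
  have hne : (spectrum ℝ M).Nonempty := hspec ▸ Set.range_nonempty _
  set a := sInf (spectrum ℝ M) with ha
  set b := sSup (spectrum ℝ M) with hb
  have ha0 : 0 < a := by
    have h : a ∈ spectrum ℝ M := hne.csInf_mem hfin
    obtain ⟨i, hi⟩ := hspec ▸ h
    rw [← hi]
    exact hM.eigenvalues_pos i
  have hab : a ≤ b := csInf_le_csSup hne hfin.bddBelow hfin.bddAbove
  have hlo : algebraMap ℝ (Matrix (Fin n) (Fin n) ℝ) a ≤ M :=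
    algebraMap_le_of_le_spectrum (fun x hx => csInf_le hfin.bddBelow hx) hM.1
  have hup : M ≤ algebraMap ℝ (Matrix (Fin n) (Fin n) ℝ) b :=
    le_algebraMap_of_spectrum_le (fun x hx => le_csSup hfin.bddAbove hx) hM.1
  have hdiag : ∀ i, M i i ≤ b := fun i => by
    have := (le_iff.1 hup).diag_nonneg (i := i)
    simpa [Matrix.algebraMap_matrix_apply] using this
  have hc : condNumber M = b / a := rfl
  refine ⟨by rw [hc, le_div_iff₀ ha0]; linarith, fun i => le_trans ?_ hlo⟩
  rw [Algebra.algebraMap_eq_smul_one, le_iff, ← sub_smul]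
  refine PosSemidef.one.smul (sub_nonneg.2 ?_)
  rw [hc, inv_div, div_mul_eq_mul_div, div_le_iff₀ (ha0.trans_le hab)]
  exact mul_le_mul_of_nonneg_left (hdiag i) ha0.le

open scoped MatrixOrder in
theorem isDominantPair_of_isSDDM [NeZero n] {κ : ℝ} {D A : Matrix (Fin n) (Fin n) ℝ}
    (hD : D.IsDiag) (hA : EntrywiseNonneg A) (hA0 : ∀ i, A i i = 0) (h : IsSDDM (D - A))
    (hκ : condNumber (D - A) ≤ κ) : 1 ≤ κ ∧ IsDominantPair κ⁻¹ D A := by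
  obtain ⟨h1, h2⟩ := condNumber_spec h.posDef
  have hκ1 : 1 ≤ κ := h1.trans hκ
  have hdiag : ∀ i, (D - A) i i = D i i := fun i => by simp [hA0]
  have hpos : ∀ i, 0 < D i i := fun i => hdiag i ▸ h.posDef.diag_pos
  have hDd : D = diagonal fun i => D i i := hD.diagonal_diag.symm
  refine ⟨hκ1, hD, hpos, ?_, hA, fun i => ?_, ?_⟩
  · have := hD.isSymm.sub h.sdd.symm
    rwa [sub_sub_cancel] at this
  · have h3 := h.sdd.dominant i
    rw [hdiag] at h3
    rw [← Finset.add_sum_erase _ _ (Finset.mem_univ i), hA0, zero_add]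
    refine le_trans (Finset.sum_le_sum fun j hj => ?_) h3
    rw [Matrix.sub_apply, hD (Finset.ne_of_mem_erase hj).symm, zero_sub, abs_neg]
    exact le_abs_self _
  · obtain ⟨k, -, hk⟩ := Finset.exists_max_image Finset.univ (fun i => D i i)
      ⟨(0 : Fin n), Finset.mem_univ _⟩
    have h3 := le_iff.1 (h2 k)
    rw [hdiag] at h3
    have h4 : (((condNumber (D - A))⁻¹ * D k k) • (1 : Matrix (Fin n) (Fin n) ℝ) -
        κ⁻¹ • D).PosSemidef := by
      have e : ((condNumber (D - A))⁻¹ * D k k) • (1 : Matrix (Fin n) (Fin n) ℝ) - κ⁻¹ • D =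
          diagonal fun i => (condNumber (D - A))⁻¹ * D k k - κ⁻¹ * D i i := by
        rw [← diagonal_sub, smul_one_eq_diagonal]
        congr 1
        conv_lhs => rw [hDd]
        ext i j
        by_cases hij : i = j
        · subst hij; simp
        · simp [hij]
      rw [e]
      refine .diagonal fun i => sub_nonneg.2 ?_
      have := hpos i
      gcongr
      exact hk i (Finset.mem_univ i)
    have := h3.add h4
    rwa [sub_add_sub_cancel] at this

/-- A chain of `d` levels with accuracy `1 / d` each, from a gap that grows by the factor
`exp (1 / 10)` until it reaches `1 / 2`. -/
theorem exists_chain [NeZero n] {L : ℝ} {D₀ A₀ : Matrix (Fin n) (Fin n) ℝ}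
    (h : IsDominantPair (Real.exp (-L)) D₀ A₀) {d : ℕ} (hd : 20 ≤ d) (hdL : 10 * L ≤ d) :
    ∃ D A : ℕ → Matrix (Fin n) (Fin n) ℝ, D 0 = D₀ ∧ A 0 = A₀ ∧
      IsApproxInverseChain d D A ∧ (chainSize d D A : ℝ) ≤ 258 * n * d ^ 3 := by
  have hn : (1 : ℝ) ≤ n := by exact_mod_cast NeZero.one_le
  have hd' : (20 : ℝ) ≤ d := by exact_mod_cast hd
  have hd0 : (0 : ℝ) < d := by linarith
  set ε : ℝ := 1 / d with hε
  have hε0 : 0 < ε := by positivity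
  have hε1 : ε ≤ 1 / 20 := one_div_le_one_div_of_le (by norm_num) hd'
  -- The cap keeps within the range where squaring gains 3/2. The rate is safe: exp (1/10) ≤ 10/9 <
  -- (3/2)(9/10), and 9/10 ≤ exp (-2ε) as d ≥ 20.
  set lam : ℕ → ℝ := fun i => min (1 / 2) (Real.exp (i / 10 - L)) with hlam
  have hlam0 : ∀ i, 0 < lam i := fun i => lt_min (by norm_num) (Real.exp_pos _)
  have hlam1 : ∀ i, lam i ≤ 1 / 2 := fun i => min_le_left _ _
  have hgrow : ∀ i, lam (i + 1) ≤ Real.exp (-(2 * ε)) * (3 / 2 * lam i) := by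
    intro i
    have e1 : Real.exp (1 / 10) ≤ 10 / 9 := by
      have h1 := Real.add_one_le_exp (-(1 / 10 : ℝ))
      have h2 : Real.exp (1 / 10) * Real.exp (-(1 / 10)) = 1 := by
        rw [← Real.exp_add]; norm_num
      nlinarith [Real.exp_pos (1 / 10)]
    have e2 : 9 / 10 ≤ Real.exp (-(2 * ε)) := by
      linarith [Real.add_one_le_exp (-(2 * ε))]
    have e3 : lam (i + 1) ≤ Real.exp (1 / 10) * lam i := by
      rw [hlam]
      simp only
      rw [mul_min_of_nonneg _ _ (Real.exp_pos _).le, ← Real.exp_add]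
      refine min_le_min ?_ (le_of_eq ?_)
      · linarith [Real.add_one_le_exp (1 / 10 : ℝ)]
      · congr 1; push_cast; ring
    have := hlam0 i
    nlinarith
  have h0 : IsDominantPair (lam 0) D₀ A₀ := h.mono (by simp [hlam])
  let P : ℕ → Type := fun i =>
    {x : Matrix (Fin n) (Fin n) ℝ × Matrix (Fin n) (Fin n) ℝ // IsDominantPair (lam i) x.1 x.2}
  have hstep : ∀ i (x : P i), ∃ y : P (i + 1),
      Approx ε (y.1.1 - y.1.2) (x.1.1 - x.1.2 * (x.1.1)⁻¹ * x.1.2) ∧ Approx ε y.1.1 x.1.1 ∧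
      (nnz y.1.1 : ℝ) ≤ n ∧ (nnz y.1.2 : ℝ) ≤ n + 256 * n / ε ^ 2 := by
    rintro i ⟨⟨D, A⟩, hx⟩
    obtain ⟨D', A', h1, h2⟩ := hx.exists_next (hlam0 i) (hlam1 i) hε0 (by linarith)
    exact ⟨⟨(D', A'), h1.mono (hgrow i)⟩, h2⟩
  choose next hnext using hstep
  let f : (i : ℕ) → P i := fun i => Nat.rec ⟨(D₀, A₀), h0⟩ next i
  have hf : ∀ i, f (i + 1) = next i (f i) := fun i => rfl
  have hlast : lam d = 1 / 2 := by
    refine min_eq_left ?_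
    have : (1 : ℝ) ≤ Real.exp (d / 10 - L) := Real.one_le_exp (by linarith)
    linarith
  refine ⟨fun i => (f i).1.1, fun i => (f i).1.2, rfl, rfl, ⟨fun i _ => (f i).2.isDiag,
    fun i _ j k => ?_, fun i _ => (f i).2.symm, fun i _ => (f i).2.nonneg,
    fun i _ => (f i).2.posDef (hlam0 i), fun i => if i < d then ε else 1, ?_, ?_, ?_, ?_⟩, ?_⟩
  · by_cases hjk : j = k
    · subst hjk; exact ((f i).2.diag_pos j).le
    · exact ((f i).2.isDiag hjk).ge
  -- The budget is d · (1 / d) + 1 = 2.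
  · rw [Finset.sum_range_succ, Finset.sum_congr rfl fun i hi => if_pos (Finset.mem_range.1 hi)]
    simp only [Finset.sum_const, Finset.card_range, nsmul_eq_mul, lt_irrefl, if_false, hε]
    rw [mul_one_div_cancel hd0.ne']
    norm_num
  · intro i hi
    simp only [if_pos hi]
    exact (hnext i (f i)).1
  · intro i hi
    simp only [if_pos hi]
    exact (hnext i (f i)).2.1
  · simp only [lt_irrefl, if_false]
    have he : 2 ≤ Real.exp 1 := by linarith [Real.add_one_le_exp (1 : ℝ)]
    refine (f d).2.approx_diag ?_ ?_
    · rw [hlast, Real.exp_neg, one_div]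
      gcongr
    · rw [hlast]; linarith
  · rw [chainSize, Nat.cast_sum]
    calc _ ≤ ∑ i ∈ Finset.Icc 1 d, 258 * (n : ℝ) * d ^ 2 := by
          refine Finset.sum_le_sum fun i hi => ?_
          obtain ⟨j, rfl⟩ := Nat.exists_eq_add_of_le' (Finset.mem_Icc.1 hi).1
          have h1 := (hnext j (f j)).2.2.1
          have h2 := (hnext j (f j)).2.2.2
          have h3 : 256 * (n : ℝ) / ε ^ 2 = 256 * n * d ^ 2 := by
            rw [hε]; field_simp
          rw [h3] at h2
          rw [Nat.cast_add, hf]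
          have h4 : (n : ℝ) ≤ n * d ^ 2 := le_mul_of_one_le_right (by linarith) (by nlinarith)
          linarith
      _ = _ := by
          rw [Finset.sum_const, Nat.card_Icc, nsmul_eq_mul, Nat.add_sub_cancel]
          ring

end Main
end InverseChain

theorem mainTheorem4 :
    ∃ C : ℝ, 0 < C ∧
      ∀ (n : ℕ) (κ : ℝ) (D₀ A₀ : Matrix (Fin n) (Fin n) ℝ),
        0 < n →
        D₀.IsDiag →
        InverseChain.EntrywiseNonneg A₀ →
        (∀ i, A₀ i i = 0) →
        InverseChain.IsSDDM (D₀ - A₀) →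
        InverseChain.condNumber (D₀ - A₀) ≤ κ →
        ∃ (d : ℕ) (D A : ℕ → Matrix (Fin n) (Fin n) ℝ),
          D 0 = D₀ ∧ A 0 = A₀ ∧
          InverseChain.IsApproxInverseChain d D A ∧
          (d : ℝ) ≤ C * Real.log κ ∧
          (InverseChain.chainSize d D A : ℝ) ≤ C * (n * Real.log κ ^ 3) := by
  refine ⟨400000, by norm_num, fun n κ D₀ A₀ hn hD hA hA0 hM hκ => ?_⟩
  have : NeZero n := ⟨hn.ne'⟩
  obtain ⟨hκ1, h⟩ := InverseChain.isDominantPair_of_isSDDM hD hA hA0 hM hκ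
  have hκ0 : 0 < κ := by linarith
  set L := Real.log κ with hL
  have hL0 : 0 ≤ L := Real.log_nonneg hκ1
  have hexp : κ⁻¹ = Real.exp (-L) := by rw [Real.exp_neg, hL, Real.exp_log hκ0]
  rw [hexp] at h
  -- When log κ is near 0 the bound on d forces d = 0; up to L = 2 the empty chain suffices,
  -- spending the whole error 2 on the final comparison.
  rcases le_or_gt L 2 with hL2 | hL2
  · refine ⟨0, fun _ => D₀, fun _ => A₀, rfl, rfl, ⟨fun _ _ => hD, fun _ _ i j => ?_,
      fun _ _ => h.symm, fun _ _ => hA, fun _ _ => hM.posDef, fun _ => 2, by simp, by simp,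
      by simp, ?_⟩, ?_, ?_⟩
    · by_cases hij : i = j
      · subst hij; exact (h.diag_pos i).le
      · exact (hD hij).ge
    · refine h.approx_diag (Real.exp_le_exp.2 (by linarith)) ?_
      linarith [Real.add_one_le_exp (2 : ℝ), Real.exp_pos (-L)]
    · rw [Nat.cast_zero]; positivity
    · simp only [InverseChain.chainSize, Finset.Icc_eq_empty_of_lt Nat.zero_lt_one,
        Finset.sum_empty, Nat.cast_zero]
      positivity
  -- L > 2 gives both d ≥ 20 and d ≤ 11 L, whence the constant 258 · 11^3.
  · set d := ⌈10 * L⌉₊ with hd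
    have hd1 : 10 * L ≤ d := Nat.le_ceil _
    have hd2 : (d : ℝ) < 10 * L + 1 := Nat.ceil_lt_add_one (by positivity)
    have hd3 : 20 ≤ d := by
      have : (20 : ℝ) ≤ d := by linarith
      exact_mod_cast this
    obtain ⟨D, A, hD0, hA0', hchain, hsize⟩ := InverseChain.exists_chain h hd3 hd1
    refine ⟨d, D, A, hD0, hA0', hchain, by linarith, hsize.trans ?_⟩
    calc 258 * (n : ℝ) * d ^ 3 ≤ 258 * n * (11 * L) ^ 3 := by
          gcongr
          linarith
      _ = 343398 * (n * L ^ 3) := by ring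
      _ ≤ 400000 * (n * L ^ 3) := by
          have : 0 ≤ (n : ℝ) * L ^ 3 := by positivity
          linarith
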